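/- Let $(a_n)_{n\in\mathbb{Z}}$ be a sequence of complex numbers with $\sum_{n\in\mathbb{Z}}|a_n|^2<\infty$ such that $a_n\in\mathbb{Z}$ for all $n\ge 0$. Let $\mathrm{sinc}(z)=\sin(\pi z)/(\pi z)$ for $z\in\mathbb{C}\setminus\{0\}$ and $\mathrm{sinc}(0)=1$. Then the series $$f(z)=\sum_{n\in\mathbb{Z}}a_n\,\mathrm{sinc}(z-n)$$ converges absolutely for every $z\in\mathbb{C}$ and defines an entire function of some exponential type $\sigma\le\pi$; if moreover the $a_n$ are not all zero, then $0.8\le\sigma\le\pi$. Here an entire function $f$ is said to be of exponential type $\sigma$ if there are constants $M,\tau>0$ with $|f(z)|\le M e^{\tau|z|}$ for all $z\in\mathbb{C}$, and $\sigma$ is the infimum of all $\tau>0$ for which such an $M$ exists. Moreover, only finitely many of the $a_n$ with $n\ge 0$ are nonzero. -/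

import Mathlib

/-- The normalized cardinal sine on `ℂ`: `sin (π z) / (π z)`, with the removable singularity at
`0` filled in by the value `1`. -/
noncomputable def complexSinc (z : ℂ) : ℂ :=
  if z = 0 then 1 else Complex.sin (Real.pi * z) / (Real.pi * z)

/-- The sum of the cardinal series `∑_{n ∈ ℤ} a n * sinc (z - n)`. -/
noncomputable def cardinalSeries (a : ℤ → ℂ) (z : ℂ) : ℂ :=
  ∑' n : ℤ, a n * complexSinc (z - n)

/-- The set of exponents `τ > 0` such that `|f z| ≤ M * exp (τ |z|)` on `ℂ` for some `M > 0`. -/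
def growthExponents (f : ℂ → ℂ) : Set ℝ :=
  {τ : ℝ | 0 < τ ∧ ∃ M : ℝ, 0 < M ∧ ∀ z : ℂ, ‖f z‖ ≤ M * Real.exp (τ * ‖z‖)}

/-- `f` is an entire function of exponential type `σ`: it is complex differentiable everywhere,
it satisfies at least one bound `|f z| ≤ M * exp (τ |z|)`, and `σ` is the infimum of all such
`τ`. -/
def HasExponentialType (f : ℂ → ℂ) (σ : ℝ) : Prop :=
  Differentiable ℂ f ∧ (growthExponents f).Nonempty ∧ IsGLB (growthExponents f) σ

/-! For the upper bound, `sinc (z - n)` is at most a constant times `(1 + |z|) e^{π|z|} / (1 +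
|n|)`, and `|a n| / (1 + |n|)` is summable; this gives convergence, holomorphy and type at most `π`.
For the lower bound, square-summable integers are eventually zero, and the series takes the value `a
m` at each integer `m`. If `N` is the last index with `a N ≠ 0`, then `g z = f (z + N)` vanishes at
`1, 2, 3, ...` but not at `0`. Jensen's inequality on `|z| = n` (`norm_zero_mul_pow_card_le`) and a
Stirling bound (`exp_natCast_mul_factorial_le`) give `|g 0| ≤ M e n e^{(τ - 1) n}`, so `τ ≥ 1`,
which is stronger than `0.8`. -/

/-! ### Bounds for the cardinal sine -/

theorem complexSinc_eq_dslope (z : ℂ) :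
    complexSinc z = dslope Complex.sin 0 (Real.pi * z) := by
  have hpi : (Real.pi : ℂ) ≠ 0 := by exact_mod_cast Real.pi_ne_zero
  by_cases hz : z = 0
  · simp [complexSinc, hz]
  · rw [dslope_of_ne _ (mul_ne_zero hpi hz), slope_def_field]
    simp [complexSinc, hz]

theorem differentiable_dslope {f : ℂ → ℂ} (hf : Differentiable ℂ f) (c : ℂ) :
    Differentiable ℂ (dslope f c) := by
  rw [← differentiableOn_univ] at hf ⊢
  exact (Complex.differentiableOn_dslope Filter.univ_mem).2 hf

theorem differentiable_complexSinc : Differentiable ℂ complexSinc := by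
  have h : complexSinc = fun z => dslope Complex.sin 0 (Real.pi * z) :=
    funext complexSinc_eq_dslope
  rw [h]
  exact (differentiable_dslope Complex.differentiable_sin 0).comp (by fun_prop)

theorem complexSinc_int (k : ℤ) : complexSinc k = if k = 0 then 1 else 0 := by
  by_cases hk : k = 0
  · simp [complexSinc, hk]
  · have : Complex.sin (Real.pi * (k : ℂ)) = 0 := by
      rw [mul_comm]; exact Complex.sin_int_mul_pi k
    simp [complexSinc, hk, this]

theorem norm_sin_le_exp_abs_im (z : ℂ) : ‖Complex.sin z‖ ≤ Real.exp |z.im| := by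
  have h1 : ‖Complex.exp (-z * Complex.I)‖ ≤ Real.exp |z.im| := by
    rw [Complex.norm_exp]
    apply Real.exp_le_exp.2
    simpa using le_abs_self z.im
  have h2 : ‖Complex.exp (z * Complex.I)‖ ≤ Real.exp |z.im| := by
    rw [Complex.norm_exp]
    apply Real.exp_le_exp.2
    simpa using neg_le_abs z.im
  rw [Complex.sin, norm_div, norm_mul, Complex.norm_I, mul_one, Complex.norm_two]
  linarith [norm_sub_le (Complex.exp (-z * Complex.I)) (Complex.exp (z * Complex.I))]

theorem exists_norm_complexSinc_le :
    ∃ C : ℝ, 0 < C ∧ ∀ w : ℂ, ‖complexSinc w‖ ≤ C * Real.exp (Real.pi * |w.im|) / (1 + ‖w‖) := by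
  obtain ⟨B, hB⟩ := (isCompact_closedBall (0 : ℂ) 1).exists_bound_of_continuousOn
    differentiable_complexSinc.continuous.continuousOn
  have hB0 : 0 ≤ B := (norm_nonneg _).trans (hB 0 (by simp))
  refine ⟨2 * B + 1, by linarith, fun w => ?_⟩
  rw [le_div_iff₀ (by positivity)]
  have he : 1 ≤ Real.exp (Real.pi * |w.im|) := Real.one_le_exp (by positivity)
  rcases le_or_gt ‖w‖ 1 with hw | hw
  · have h1 := hB w (by simpa using hw)
    calc ‖complexSinc w‖ * (1 + ‖w‖) ≤ B * 2 := by
          apply mul_le_mul h1 (by linarith) (by positivity) hB0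
      _ ≤ (2 * B + 1) * 1 := by linarith
      _ ≤ _ := by gcongr
  · have hw0 : w ≠ 0 := by rintro rfl; simp at hw; linarith
    have hs : ‖Complex.sin (Real.pi * w)‖ ≤ Real.exp (Real.pi * |w.im|) := by
      refine (norm_sin_le_exp_abs_im _).trans (le_of_eq ?_)
      simp [abs_mul, abs_of_pos Real.pi_pos]
    have hn : ‖(Real.pi : ℂ) * w‖ = Real.pi * ‖w‖ := by
      simp [abs_of_pos Real.pi_pos]
    rw [complexSinc, if_neg hw0, norm_div, hn, div_mul_eq_mul_div,
      div_le_iff₀ (by positivity)]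
    calc ‖Complex.sin (Real.pi * w)‖ * (1 + ‖w‖)
        ≤ Real.exp (Real.pi * |w.im|) * (Real.pi * ‖w‖) := by
          gcongr
          nlinarith [Real.pi_gt_three]
      _ ≤ (2 * B + 1) * Real.exp (Real.pi * |w.im|) * (Real.pi * ‖w‖) := by
          gcongr
          nlinarith

theorem exists_norm_complexSinc_sub_int_le :
    ∃ C : ℝ, 0 < C ∧ ∀ (z : ℂ) (n : ℤ), ‖complexSinc (z - n)‖ ≤
      C * ((1 + ‖z‖) * Real.exp (Real.pi * ‖z‖)) * (1 + |(n : ℝ)|)⁻¹ := by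
  obtain ⟨C, hC, h⟩ := exists_norm_complexSinc_le
  refine ⟨C, hC, fun z n => (h _).trans ?_⟩
  have him : |(z - n).im| ≤ ‖z‖ := by simpa using Complex.abs_im_le_norm z
  have hn : |(n : ℝ)| ≤ ‖z‖ + ‖z - n‖ := by
    have h1 := norm_sub_le z (z - n)
    rw [sub_sub_cancel, Complex.norm_intCast] at h1
    exact h1
  rw [← div_eq_mul_inv, div_le_div_iff₀ (by positivity) (by positivity)]
  calc C * Real.exp (Real.pi * |(z - n).im|) * (1 + |(n : ℝ)|)
      ≤ C * Real.exp (Real.pi * ‖z‖) * ((1 + ‖z‖) * (1 + ‖z - n‖)) := by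
        gcongr
        -- This is `1 + |n| ≤ (1 + |z|) (1 + |z - n|)`, a consequence of `hn`.
        nlinarith [norm_nonneg z, norm_nonneg (z - n),
          mul_nonneg (norm_nonneg z) (norm_nonneg (z - n))]
    _ = _ := by ring

/-! ### Convergence and growth of the cardinal series -/

theorem summable_norm_mul_inv_one_add_abs {a : ℤ → ℂ} (ha : Summable fun n => ‖a n‖ ^ 2) :
    Summable fun n : ℤ => ‖a n‖ * (1 + |(n : ℝ)|)⁻¹ := by
  have hz : Summable fun n : ℤ => ((1 + |(n : ℝ)|)⁻¹) ^ 2 := by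
    have hnat : Summable fun n : ℕ => ((1 + (n : ℝ))⁻¹) ^ 2 := by
      have := (summable_nat_add_iff 1).2 (Real.summable_nat_pow_inv.2 one_lt_two)
      refine this.congr fun n => ?_
      push_cast
      rw [inv_pow, add_comm]
    refine Summable.of_nat_of_neg ?_ ?_ <;> simpa using hnat
  refine Summable.of_nonneg_of_le (fun n => by positivity) (fun n => ?_) (ha.add hz)
  -- The comparison is `x y ≤ x² + y²`.
  nlinarith [sq_nonneg (‖a n‖ - (1 + |(n : ℝ)|)⁻¹), sq_nonneg ‖a n‖,
    sq_nonneg ((1 + |(n : ℝ)|)⁻¹)]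

theorem exists_norm_cardinalSeries_term_le (a : ℤ → ℂ) :
    ∃ C : ℝ, 0 < C ∧ ∀ (z : ℂ) (n : ℤ), ‖a n * complexSinc (z - n)‖ ≤
      C * ((1 + ‖z‖) * Real.exp (Real.pi * ‖z‖)) * (‖a n‖ * (1 + |(n : ℝ)|)⁻¹) := by
  obtain ⟨C, hC, h⟩ := exists_norm_complexSinc_sub_int_le
  refine ⟨C, hC, fun z n => ?_⟩
  rw [norm_mul]
  calc _ ≤ ‖a n‖ * _ := mul_le_mul_of_nonneg_left (h z n) (norm_nonneg _)
    _ = _ := by ring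

theorem summable_cardinalSeries {a : ℤ → ℂ} (ha : Summable fun n => ‖a n‖ ^ 2) (z : ℂ) :
    Summable fun n : ℤ => a n * complexSinc (z - n) := by
  obtain ⟨C, -, h⟩ := exists_norm_cardinalSeries_term_le a
  exact Summable.of_norm_bounded ((summable_norm_mul_inv_one_add_abs ha).mul_left _) (h z)

theorem differentiable_cardinalSeries {a : ℤ → ℂ} (ha : Summable fun n => ‖a n‖ ^ 2) :
    Differentiable ℂ (cardinalSeries a) := by
  obtain ⟨C, hC, h⟩ := exists_norm_cardinalSeries_term_le a
  intro z
  have hd : DifferentiableOn ℂ (fun w => ∑' n : ℤ, a n * complexSinc (w - n))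
      (Metric.ball 0 (‖z‖ + 1)) := by
    refine Complex.differentiableOn_tsum_of_summable_norm
      ((summable_norm_mul_inv_one_add_abs ha).mul_left
        (C * ((1 + (‖z‖ + 1)) * Real.exp (Real.pi * (‖z‖ + 1)))))
      (fun n => ?_) Metric.isOpen_ball (fun n w hw => (h w n).trans ?_)
    · exact ((differentiable_complexSinc.comp (differentiable_id.sub_const _)).const_mul
        (a n)).differentiableOn
    · have hw' : ‖w‖ ≤ ‖z‖ + 1 := (mem_ball_zero_iff.1 hw).le
      gcongr
  exact hd.differentiableAt (Metric.isOpen_ball.mem_nhds (by simp))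

theorem exists_norm_cardinalSeries_le {a : ℤ → ℂ} (ha : Summable fun n => ‖a n‖ ^ 2) :
    ∃ K : ℝ, 0 < K ∧ ∀ z : ℂ,
      ‖cardinalSeries a z‖ ≤ K * ((1 + ‖z‖) * Real.exp (Real.pi * ‖z‖)) := by
  obtain ⟨C, hC, h⟩ := exists_norm_cardinalSeries_term_le a
  have hs := summable_norm_mul_inv_one_add_abs ha
  have h0 : 0 ≤ ∑' n : ℤ, ‖a n‖ * (1 + |(n : ℝ)|)⁻¹ := tsum_nonneg fun n => by positivity
  refine ⟨C * (∑' n : ℤ, ‖a n‖ * (1 + |(n : ℝ)|)⁻¹ + 1), by positivity, fun z => ?_⟩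
  refine (tsum_of_norm_bounded (hs.mul_left _).hasSum (h z)).trans ?_
  rw [tsum_mul_left]
  have : 0 ≤ C * ((1 + ‖z‖) * Real.exp (Real.pi * ‖z‖)) := by positivity
  nlinarith

/-- The factor `1 + |z|` is absorbed by `e^{ε|z|}`, so every exponent above `π` is admissible. -/
theorem mem_growthExponents_cardinalSeries {a : ℤ → ℂ} (ha : Summable fun n => ‖a n‖ ^ 2)
    {ε : ℝ} (hε : 0 < ε) : Real.pi + ε ∈ growthExponents (cardinalSeries a) := by
  obtain ⟨K, hK, h⟩ := exists_norm_cardinalSeries_le ha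
  refine ⟨by positivity, K * (1 + ε⁻¹), by positivity, fun z => (h z).trans ?_⟩
  have h1 : 1 + ‖z‖ ≤ (1 + ε⁻¹) * Real.exp (ε * ‖z‖) := by
    have h2 : ε * ‖z‖ + 1 ≤ Real.exp (ε * ‖z‖) := Real.add_one_le_exp _
    calc 1 + ‖z‖ ≤ (1 + ε⁻¹) * (ε * ‖z‖ + 1) := by
          have : (1 + ε⁻¹) * (ε * ‖z‖ + 1) = 1 + ‖z‖ + (ε * ‖z‖ + ε⁻¹) := by
            field_simp; ring
          rw [this]
          have : 0 ≤ ε * ‖z‖ + ε⁻¹ := by positivity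
          linarith
      _ ≤ _ := by gcongr
  calc K * ((1 + ‖z‖) * Real.exp (Real.pi * ‖z‖))
      ≤ K * (((1 + ε⁻¹) * Real.exp (ε * ‖z‖)) * Real.exp (Real.pi * ‖z‖)) := by gcongr
    _ = K * (1 + ε⁻¹) * Real.exp ((Real.pi + ε) * ‖z‖) := by
        rw [add_mul Real.pi, Real.exp_add]; ring

theorem cardinalSeries_int (a : ℤ → ℂ) (m : ℤ) : cardinalSeries a m = a m := by
  rw [cardinalSeries, tsum_eq_single m]
  · simp [complexSinc]
  · intro n hn
    rw [← Int.cast_sub, complexSinc_int, if_neg (sub_ne_zero.2 hn.symm), mul_zero]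

/-! ### Jensen's inequality and zeros at the positive integers -/

/-- An entire function vanishing on a finite set is divisible by the corresponding polynomial. -/
theorem exists_eq_prod_sub_mul {g : ℂ → ℂ} (hg : Differentiable ℂ g) (s : Finset ℂ)
    (hs : ∀ c ∈ s, g c = 0) :
    ∃ h : ℂ → ℂ, Differentiable ℂ h ∧ ∀ z, g z = (∏ c ∈ s, (z - c)) * h z := by
  induction s using Finset.induction_on with
  | empty => exact ⟨g, hg, by simp⟩
  | insert c s hc ih =>
    obtain ⟨h, hh, hgh⟩ := ih fun d hd => hs d (Finset.mem_insert_of_mem hd)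
    have hcz : h c = 0 := by
      have h1 := hgh c
      rw [hs c (Finset.mem_insert_self c s)] at h1
      refine (mul_eq_zero.1 h1.symm).resolve_left (Finset.prod_ne_zero_iff.2 fun d hd => ?_)
      exact sub_ne_zero.2 fun e => hc (e ▸ hd)
    refine ⟨dslope h c, differentiable_dslope hh c, fun z => ?_⟩
    have h2 : (z - c) * dslope h c z = h z := by
      have := sub_smul_dslope h c z
      simpa [hcz] using this
    rw [Finset.prod_insert hc, hgh z, ← h2]
    ring

/-- On the circle `‖z‖ = R`, `‖R² - conj c * z‖ = R ‖z - c‖`. -/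
theorem norm_sq_sub_conj_mul {R : ℝ} {z : ℂ} (hz : ‖z‖ = R) (c : ℂ) :
    ‖(R : ℂ) ^ 2 - starRingEnd ℂ c * z‖ = R * ‖z - c‖ := by
  have h : (R : ℂ) ^ 2 - starRingEnd ℂ c * z = z * starRingEnd ℂ (z - c) := by
    rw [map_sub, mul_sub, Complex.mul_conj, Complex.normSq_eq_norm_sq, hz]
    push_cast
    ring
  rw [h, norm_mul, RCLike.norm_conj, hz]

/-- Jensen's inequality for an entire function with finitely many prescribed zeros. -/
theorem norm_zero_mul_pow_card_le {g : ℂ → ℂ} (hg : Differentiable ℂ g) (s : Finset ℂ)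
    (hs : ∀ c ∈ s, g c = 0) {R B : ℝ} (hR : 0 < R) (hB : ∀ z, ‖z‖ = R → ‖g z‖ ≤ B) :
    ‖g 0‖ * R ^ s.card ≤ B * ∏ c ∈ s, ‖c‖ := by
  obtain ⟨h, hh, hgh⟩ := exists_eq_prod_sub_mul hg s hs
  -- Blaschke-type replacement: each factor `z - c` becomes `R² - conj c * z`, of modulus `R |z -
  -- c|` on the circle but `R²` at `0`. The maximum principle then compares `H 0` with the circle.
  let H : ℂ → ℂ := fun z => (∏ c ∈ s, ((R : ℂ) ^ 2 - starRingEnd ℂ c * z)) * h z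
  have hH : Differentiable ℂ H :=
    (Differentiable.fun_finsetProd fun c _ => by fun_prop).mul hh
  have hfr : ∀ z ∈ frontier (Metric.ball (0 : ℂ) R), ‖H z‖ ≤ R ^ s.card * B := by
    intro z hz
    rw [frontier_ball _ hR.ne', mem_sphere_zero_iff_norm] at hz
    have h1 := hB z hz
    rw [hgh, norm_mul, norm_prod] at h1
    simp only [H]
    rw [norm_mul, norm_prod, Finset.prod_congr rfl fun c _ => norm_sq_sub_conj_mul hz c,
      Finset.prod_mul_distrib, Finset.prod_const, mul_assoc]
    gcongr
  have h0 := Complex.norm_le_of_forall_mem_frontier_norm_le Metric.isBounded_ball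
    hH.diffContOnCl hfr (subset_closure (Metric.mem_ball_self hR))
  have hH0 : ‖H 0‖ = R ^ s.card * (R ^ s.card * ‖h 0‖) := by
    simp only [H, mul_zero, sub_zero, Finset.prod_const, norm_mul, norm_pow, Complex.norm_real,
      Real.norm_of_nonneg hR.le]
    ring
  rw [hH0] at h0
  have h3 := le_of_mul_le_mul_left h0 (by positivity)
  have h4 : ‖g 0‖ = (∏ c ∈ s, ‖c‖) * ‖h 0‖ := by
    rw [hgh 0, norm_mul, norm_prod]
    simp
  rw [h4]
  calc (∏ c ∈ s, ‖c‖) * ‖h 0‖ * R ^ s.card = (∏ c ∈ s, ‖c‖) * (R ^ s.card * ‖h 0‖) := by ring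
    _ ≤ (∏ c ∈ s, ‖c‖) * B := by gcongr
    _ = _ := mul_comm _ _

theorem norm_zero_mul_pow_le_factorial {g : ℂ → ℂ} (hg : Differentiable ℂ g)
    (hz : ∀ k : ℕ, 1 ≤ k → g k = 0) {n : ℕ} (hn : 1 ≤ n) {B : ℝ}
    (hB : ∀ z, ‖z‖ = n → ‖g z‖ ≤ B) :
    ‖g 0‖ * (n : ℝ) ^ n ≤ B * (n.factorial : ℝ) := by
  have hn0 : (0 : ℝ) < n := by exact_mod_cast hn
  have h := norm_zero_mul_pow_card_le hg ((Finset.Icc 1 n).image fun k : ℕ => (k : ℂ))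
    (by
      intro c hc
      obtain ⟨k, hk, rfl⟩ := Finset.mem_image.1 hc
      exact hz k (Finset.mem_Icc.1 hk).1) hn0 hB
  rw [Finset.card_image_of_injective _ Nat.cast_injective,
    Finset.prod_image fun x _ y _ e => Nat.cast_injective e] at h
  simp only [Complex.norm_natCast, Nat.card_Icc, Nat.add_sub_cancel] at h
  rwa [← Nat.cast_prod, ← Finset.Ico_add_one_right_eq_Icc, Finset.prod_Ico_id_eq_factorial] at h

/-- The induction step amounts to `e ≤ (1 + 1/n)^(n + 1)`, which follows from `log x ≥ 1 - 1/x` at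
`x = (n + 1)/n`. -/
theorem exp_natCast_mul_factorial_le {n : ℕ} (hn : 1 ≤ n) :
    Real.exp n * (n.factorial : ℝ) ≤ Real.exp 1 * n * (n : ℝ) ^ n := by
  induction n, hn using Nat.le_induction with
  | base => simp
  | succ n hn ih =>
    have hn0 : (0 : ℝ) < n := by exact_mod_cast hn
    have hlog : 1 ≤ ((n : ℝ) + 1) * Real.log ((n + 1) / n) := by
      have h1 := Real.one_sub_inv_le_log_of_pos (x := ((n : ℝ) + 1) / n) (by positivity)
      have h2 : 1 - (((n : ℝ) + 1) / n)⁻¹ = (n + 1 : ℝ)⁻¹ := by field_simp; ring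
      rw [h2, inv_le_iff_one_le_mul₀ (by positivity)] at h1
      linarith
    have hexp : Real.exp 1 * (n : ℝ) ^ (n + 1) ≤ ((n : ℝ) + 1) ^ (n + 1) := by
      rw [← le_div_iff₀ (by positivity), ← div_pow, ← Real.exp_log (x := ((n : ℝ) + 1) / n)
        (by positivity), ← Real.exp_nat_mul]
      apply Real.exp_le_exp.2
      push_cast
      exact hlog
    rw [Nat.factorial_succ]
    push_cast
    rw [Real.exp_add]
    calc Real.exp n * Real.exp 1 * (((n : ℝ) + 1) * n.factorial)
        = Real.exp 1 * (n + 1) * (Real.exp n * n.factorial) := by ring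
      _ ≤ Real.exp 1 * (n + 1) * (Real.exp 1 * n * (n : ℝ) ^ n) := by gcongr
      _ = Real.exp 1 * (n + 1) * (Real.exp 1 * (n : ℝ) ^ (n + 1)) := by ring
      _ ≤ _ := by gcongr

/-- An entire function of exponential type less than `1` that vanishes at all positive integers
vanishes at `0`. -/
theorem one_le_of_vanishes_on_positive_integers {g : ℂ → ℂ} (hg : Differentiable ℂ g)
    (hz : ∀ k : ℕ, 1 ≤ k → g k = 0) (h0 : g 0 ≠ 0) {τ M : ℝ}
    (hB : ∀ z, ‖g z‖ ≤ M * Real.exp (τ * ‖z‖)) : 1 ≤ τ := by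
  by_contra! hτ
  have hlim : Filter.Tendsto (fun n : ℕ => M * Real.exp 1 * ((n : ℝ) * Real.exp (-(1 - τ) * n)))
      Filter.atTop (nhds (M * Real.exp 1 * 0)) := by
    refine Filter.Tendsto.const_mul _ ?_
    have := (tendsto_rpow_mul_exp_neg_mul_atTop_nhds_zero 1 (1 - τ) (by linarith)).comp
      tendsto_natCast_atTop_atTop
    simpa [Function.comp_def] using this
  have hle : ∀ᶠ n : ℕ in Filter.atTop,
      ‖g 0‖ ≤ M * Real.exp 1 * ((n : ℝ) * Real.exp (-(1 - τ) * n)) := by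
    filter_upwards [Filter.eventually_ge_atTop 1] with n hn
    have hn0 : (0 : ℝ) < n := by exact_mod_cast hn
    have hM : 0 ≤ M := by
      have := (norm_nonneg _).trans (hB 0)
      simpa using this
    have h1 := norm_zero_mul_pow_le_factorial hg hz hn (B := M * Real.exp (τ * n))
      (fun z hz => by simpa [hz] using hB z)
    have h2 := exp_natCast_mul_factorial_le hn
    have h3 : ‖g 0‖ * (n : ℝ) ^ n * Real.exp n ≤
        M * Real.exp (τ * n) * (Real.exp 1 * n) * (n : ℝ) ^ n :=
      calc ‖g 0‖ * (n : ℝ) ^ n * Real.exp n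
          ≤ M * Real.exp (τ * n) * n.factorial * Real.exp n := by gcongr
        _ = M * Real.exp (τ * n) * (Real.exp n * n.factorial) := by ring
        _ ≤ M * Real.exp (τ * n) * (Real.exp 1 * n * (n : ℝ) ^ n) := by gcongr
        _ = _ := by ring
    have h4 : ‖g 0‖ * Real.exp n ≤ M * Real.exp (τ * n) * (Real.exp 1 * n) := by
      refine le_of_mul_le_mul_right ?_ (pow_pos hn0 n)
      linarith
    have h5 : -(1 - τ) * (n : ℝ) = τ * n - n := by ring
    rw [h5, Real.exp_sub, ← mul_div_assoc, ← mul_div_assoc, le_div_iff₀ (Real.exp_pos _)]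
    linarith
  have := ge_of_tendsto hlim hle
  rw [mul_zero] at this
  exact h0 (norm_le_zero_iff.1 this)

/-! ### Integer coefficients and the lower bound -/

/-- The terms `|a n|²` tend to `0`, whereas a nonzero integer has modulus at least `1`. -/
theorem finite_nonneg_support {a : ℤ → ℂ} (ha : Summable fun n => ‖a n‖ ^ 2)
    (hint : ∀ n : ℤ, 0 ≤ n → ∃ m : ℤ, a n = (m : ℂ)) :
    {n : ℤ | 0 ≤ n ∧ a n ≠ 0}.Finite := by
  have h := ha.tendsto_cofinite_zero.eventually (gt_mem_nhds one_pos)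
  refine (Filter.eventually_cofinite.1 h).subset ?_
  rintro n ⟨hn, han⟩
  obtain ⟨m, hm⟩ := hint n hn
  have hm0 : m ≠ 0 := by rintro rfl; simp [hm] at han
  have h1 : (1 : ℝ) ≤ |(m : ℝ)| := by exact_mod_cast Int.one_le_abs hm0
  simp only [Set.mem_ofPred_eq, hm, Complex.norm_intCast, not_lt]
  exact one_le_pow₀ h1

theorem exists_greatest_ne_zero {a : ℤ → ℂ} (hfin : {n : ℤ | 0 ≤ n ∧ a n ≠ 0}.Finite)
    (ha : a ≠ 0) : ∃ N : ℤ, a N ≠ 0 ∧ ∀ n, N < n → a n = 0 := by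
  obtain ⟨b, hb⟩ := hfin.bddAbove
  obtain ⟨N, hN, hmax⟩ := Int.exists_greatest_of_bdd (P := fun n => a n ≠ 0)
    -- The last nonzero index may be negative, and `b` only bounds the nonnegative ones.
    ⟨max b 0, fun n hn => by
      rcases le_total 0 n with h | h
      · exact (hb ⟨h, hn⟩).trans (le_max_left _ _)
      · exact h.trans (le_max_right _ _)⟩ (Function.ne_iff.1 ha)
  exact ⟨N, hN, fun n hn => by_contra fun h => absurd (hmax n h) (not_le.2 hn)⟩

theorem one_le_of_mem_growthExponents {a : ℤ → ℂ} (ha : Summable fun n => ‖a n‖ ^ 2)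
    (hfin : {n : ℤ | 0 ≤ n ∧ a n ≠ 0}.Finite) (hne : a ≠ 0) {τ : ℝ}
    (hτ : τ ∈ growthExponents (cardinalSeries a)) : 1 ≤ τ := by
  obtain ⟨N, hN, hmax⟩ := exists_greatest_ne_zero hfin hne
  obtain ⟨hτ0, M, hM, hB⟩ := hτ
  refine one_le_of_vanishes_on_positive_integers
    -- Since `|z + N| ≤ |z| + |N|`, the translation changes only the constant, not `τ`.
    (g := fun z => cardinalSeries a (z + N)) (M := M * Real.exp (τ * ‖(N : ℂ)‖))
    ((differentiable_cardinalSeries ha).comp (differentiable_id.add_const _)) ?_ ?_ ?_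
  · intro k hk
    have h := cardinalSeries_int a (k + N)
    push_cast at h
    rw [h]
    exact hmax _ (by omega)
  · simpa [cardinalSeries_int] using hN
  · intro z
    refine (hB _).trans ?_
    rw [mul_assoc, ← Real.exp_add, ← mul_add]
    gcongr
    rw [add_comm ‖(N : ℂ)‖]
    exact norm_add_le _ _

theorem corollary3 (a : ℤ → ℂ) (ha : Summable (fun n : ℤ => ‖a n‖ ^ 2))
    (hint : ∀ n : ℤ, 0 ≤ n → ∃ m : ℤ, a n = (m : ℂ)) :
    (∀ z : ℂ, Summable (fun n : ℤ => a n * complexSinc (z - n))) ∧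
    (∃ σ : ℝ, HasExponentialType (cardinalSeries a) σ ∧
      (a ≠ 0 → (0.8 : ℝ) ≤ σ) ∧ σ ≤ Real.pi) ∧
    {n : ℤ | 0 ≤ n ∧ a n ≠ 0}.Finite := by
  have hfin := finite_nonneg_support ha hint
  have hne : (growthExponents (cardinalSeries a)).Nonempty :=
    ⟨_, mem_growthExponents_cardinalSeries ha one_pos⟩
  have hbdd : BddBelow (growthExponents (cardinalSeries a)) := ⟨0, fun τ hτ => hτ.1.le⟩
  refine ⟨summable_cardinalSeries ha, ⟨sInf (growthExponents (cardinalSeries a)),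
    ⟨differentiable_cardinalSeries ha, hne, isGLB_csInf hne hbdd⟩, fun h0 => ?_, ?_⟩, hfin⟩
  · refine le_csInf hne fun τ hτ => ?_
    have := one_le_of_mem_growthExponents ha hfin h0 hτ
    norm_num
    linarith
  · exact le_of_forall_pos_le_add fun ε hε =>
      csInf_le hbdd (mem_growthExponents_cardinalSeries ha hε)
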